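/- Let $\mathcal{A}$ be a complex unital Banach algebra with unit $1$. An element $x\in\mathcal{A}$ is called generalized Drazin invertible if there is $x^d\in\mathcal{A}$ (necessarily unique) such that $x^d x x^d=x^d$, $xx^d=x^dx$ and $x-x^2x^d$ is quasinilpotent (has spectral radius $0$). Let $\mathcal{A}^d$ denote the set of these elements, and for $x\in\mathcal{A}^d$ put $x^\pi=1-xx^d$. Let $a,b\in\mathcal{A}^d$ satisfy $a^\pi b a=a^\pi b^\pi a b b^\pi a^\pi$, and suppose that at least one of the six elements $$a^\pi b a^\pi,\quad a^\pi b,\quad b a^\pi,\quad aa^d b aa^d,\quad aa^d b,\quad b aa^d$$ belongs to $\mathcal{A}^d$. Put $e=(a+b)aa^d$. Then $$a+b\in\mathcal{A}^d\iff aa^d(a+b)\in\mathcal{A}^d\iff e\in\mathcal{A}^d\iff aa^d(a+b)aa^d\in\mathcal{A}^d .$$ If these equivalent conditions hold, then $$\begin{aligned} (a+b)^d={}&e^d+\sum_{n=0}^{\infty}a^\pi a^n(b^d)^{n+1}-\sum_{n=0}^{\infty}e^d b a^\pi a^n(b^d)^{n+1}\\ &+\sum_{n=0}^{\infty}\sum_{k=0}^{\infty}e^\pi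 e^n aa^d b a^k a^\pi (b^d)^{n+k+2} +\sum_{n=0}^{\infty}(e^d)^{n+2}b a^\pi(a+b)^n b^\pi\\ &-\sum_{n=0}^{\infty}\sum_{k=0}^{\infty}(e^d)^{n+2}b a^\pi(a+b)^n a^{k+1}(b^d)^{k+1}, \end{aligned}$$ where all the series converge unconditionally in $\mathcal{A}$, the double series as series over $(n,k)\in\mathbb{N}\times\mathbb{N}$. -/

import Mathlib

/-- `a` is quasinilpotent: its spectral radius vanishes. -/
def IsQuasinilpotent {A : Type*} [NormedRing A] [NormedAlgebra ℂ A] (a : A) : Prop :=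
  spectralRadius ℂ a = 0

/-- `x` is a generalized Drazin (Koliha-Drazin) inverse of `a`. -/
structure IsGDrazinInverse {A : Type*} [NormedRing A] [NormedAlgebra ℂ A] (a x : A) : Prop where
  outer : x * a * x = x
  comm : a * x = x * a
  quasinil : IsQuasinilpotent (a - a ^ 2 * x)

/-- `a` is generalized Drazin invertible, i.e. `a ∈ A^d`. -/
def IsGDrazinInvertible {A : Type*} [NormedRing A] [NormedAlgebra ℂ A] (a : A) : Prop :=
  ∃ x : A, IsGDrazinInverse a x

open Classical in
/-- The generalized Drazin inverse `a^d`, with the value `0` if `a` has none. -/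
noncomputable def gDrazin {A : Type*} [NormedRing A] [NormedAlgebra ℂ A] (a : A) : A :=
  if h : IsGDrazinInvertible a then h.choose else 0

/-- The spectral idempotent `a^π = 1 - a a^d`. -/
noncomputable def spectralIdem {A : Type*} [NormedRing A] [NormedAlgebra ℂ A] (a : A) : A :=
  1 - a * gDrazin a

theorem gDrazin_spec {A : Type*} [NormedRing A] [NormedAlgebra ℂ A] {a : A}
    (h : IsGDrazinInvertible a) : IsGDrazinInverse a (gDrazin a) := by
  rw [gDrazin, dif_pos h]
  exact h.choose_spec

/-- If `‖z‖ ≤ ‖x ^ n‖ * ‖y ^ n‖` for all `n ≥ 1` and `y` is quasinilpotent, then `z = 0`. -/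
theorem eq_zero_of_norm_le_pow_mul_pow {A : Type*} [NormedRing A] [NormedAlgebra ℂ A]
    [CompleteSpace A] {x y z : A} (hy : IsQuasinilpotent y)
    (hz : ∀ n : ℕ, 1 ≤ n → ‖z‖ ≤ ‖x ^ n‖ * ‖y ^ n‖) : z = 0 := by
  have hlim := spectrum.pow_norm_pow_one_div_tendsto_nhds_spectralRadius y
  rw [show spectralRadius ℂ y = 0 from hy] at hlim
  set ε : ℝ := 1 / (2 * (‖x‖ + 1)) with hε
  have hεpos : 0 < ε := by positivity
  have hev := hlim.eventually (gt_mem_nhds (ENNReal.ofReal_pos.2 hεpos))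
  have hbound : ∀ᶠ n : ℕ in Filter.atTop, ‖z‖ ≤ (1 / 2 : ℝ) ^ n := by
    filter_upwards [hev, Filter.eventually_ge_atTop 1] with n hn h1
    have hn' : ‖y ^ n‖ ^ (1 / n : ℝ) < ε := (ENNReal.ofReal_lt_ofReal_iff hεpos).1 hn
    have hyn : ‖y ^ n‖ ≤ ε ^ n := by
      have h2 : (‖y ^ n‖ ^ (1 / n : ℝ)) ^ n ≤ ε ^ n :=
        pow_le_pow_left₀ (by positivity) hn'.le n
      rwa [one_div, Real.rpow_inv_natCast_pow (norm_nonneg _) (by omega)] at h2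
    calc ‖z‖ ≤ ‖x ^ n‖ * ‖y ^ n‖ := hz n h1
      _ ≤ (‖x‖ + 1) ^ n * ε ^ n := by
        refine mul_le_mul ?_ hyn (norm_nonneg _) (by positivity)
        exact (norm_pow_le' x (show 0 < n by omega)).trans
          (pow_le_pow_left₀ (norm_nonneg _) (by linarith) n)
      _ = (1 / 2 : ℝ) ^ n := by
        rw [← mul_pow]
        congr 1
        rw [hε]
        field_simp
  have h0 : Filter.Tendsto (fun n : ℕ => (1 / 2 : ℝ) ^ n) Filter.atTop (nhds 0) :=
    tendsto_pow_atTop_nhds_zero_of_lt_one (by norm_num) (by norm_num)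
  exact norm_le_zero_iff.1 (ge_of_tendsto h0 hbound)

/-- The idempotents `x * a` and `1 - a * y` of two generalized Drazin inverses of `a`
annihilate each other. -/
theorem IsGDrazinInverse.idem_mul {A : Type*} [NormedRing A] [NormedAlgebra ℂ A]
    [CompleteSpace A] {a x y : A} (hx : IsGDrazinInverse a x) (hy : IsGDrazinInverse a y) :
    x * a * (1 - a * y) = 0 ∧ (1 - a * y) * (x * a) = 0 := by
  have hqidem : (1 - a * y) * (1 - a * y) = 1 - a * y := by
    have h : a * y * (a * y) = a * y := by
      calc a * y * (a * y) = a * (y * a * y) := by noncomm_ring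
        _ = a * y := by rw [hy.outer]
    rw [sub_mul, mul_sub, mul_sub, h]
    simp
  have hqc : Commute a (1 - a * y) := by
    show a * (1 - a * y) = (1 - a * y) * a
    rw [mul_sub, sub_mul, mul_one, one_mul, mul_assoc, ← hy.comm]
  have hpidem : IsIdempotentElem (x * a) := by
    show x * a * (x * a) = x * a
    rw [← mul_assoc, hx.outer]
  have hquasi : a - a ^ 2 * y = a * (1 - a * y) := by noncomm_ring
  have hxa : Commute x a := hx.comm.symm
  have hq : ∀ n : ℕ, 1 ≤ n → (1 - a * y) ^ n = 1 - a * y := fun n hn =>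
    IsIdempotentElem.pow_eq (show IsIdempotentElem (1 - a * y) from hqidem) (by omega)
  have hp : ∀ n : ℕ, 1 ≤ n → (x * a) ^ n = x * a := fun n hn => hpidem.pow_eq (by omega)
  have hquasi' : IsQuasinilpotent (a * (1 - a * y)) := hquasi ▸ hy.quasinil
  constructor
  · refine eq_zero_of_norm_le_pow_mul_pow (x := x) hquasi' fun n hn => ?_
    have h : x * a * (1 - a * y) = x ^ n * (a * (1 - a * y)) ^ n := by
      rw [hqc.mul_pow, hq n hn, ← mul_assoc, ← hxa.mul_pow, hp n hn]
    rw [h]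
    exact norm_mul_le _ _
  · refine eq_zero_of_norm_le_pow_mul_pow (x := x) hquasi' fun n hn => ?_
    have h : (1 - a * y) * (x * a) = (a * (1 - a * y)) ^ n * x ^ n := by
      rw [hqc.eq, hqc.symm.mul_pow, hq n hn, mul_assoc, ← hxa.symm.mul_pow, ← hxa.eq, hp n hn]
    rw [h, mul_comm ‖x ^ n‖]
    exact norm_mul_le _ _

/-- A generalized Drazin inverse is unique. -/
theorem IsGDrazinInverse.unique {A : Type*} [NormedRing A] [NormedAlgebra ℂ A]
    [CompleteSpace A] {a x y : A} (hx : IsGDrazinInverse a x) (hy : IsGDrazinInverse a y) :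
    x = y := by
  have h1 : x * a = a * y * (x * a) := by
    have h := (hx.idem_mul hy).2
    rwa [sub_mul, one_mul, sub_eq_zero] at h
  have h2 : y * a = y * a * (a * x) := by
    have h := (hy.idem_mul hx).1
    rwa [mul_sub, mul_one, sub_eq_zero] at h
  have hpq : x * a = y * a := by
    rw [h1, hy.comm, ← hx.comm, ← h2]
  calc x = x * a * x := hx.outer.symm
    _ = y * a * x := by rw [hpq]
    _ = y * (x * a) := by rw [mul_assoc, hx.comm]
    _ = y * a * y := by rw [hpq, mul_assoc, hy.comm]
    _ = y := hy.outer

/-- The value of `gDrazin` is determined by the defining relations. -/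
theorem IsGDrazinInverse.gDrazin_eq {A : Type*} [NormedRing A] [NormedAlgebra ℂ A]
    [CompleteSpace A] {a x : A} (hx : IsGDrazinInverse a x) : gDrazin a = x :=
  (gDrazin_spec ⟨x, hx⟩).unique hx

/-! Write p = aa^d and u = a^π = 1 - p. The hypothesis forces u b p = 0, so a + b is block
triangular: a + b = e + y + z with e = p(a+b)p, y = u(a+b)u and z = p b u.

The block y is always in A^d. In the corner of u, the element ua is quasinilpotent, ub is
generalized Drazin invertible with inverse u b^d (this is where one of the six elements is needed),
and the hypothesis becomes the relation required by `IsQuasinilpotent.isGDrazinInverse_add`. Hence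
y^d = T = ∑ (ua)^n (u b^d)^(n+1).

If e is in A^d, `IsGDrazinInverse.triangular` gives (a+b)^d = e^d + T + S + R - e^d z T, with
explicit series S and R. Conversely, y u = u (a+b), and generalized Drazin inverses respect
intertwining (`IsGDrazinInverse.intertwine`), so (a+b)^d is triangular too and restricts to an
inverse of e. Cline's formula covers the remaining equivalence.

The stated formula comes from expanding R through the powers of T, and S through 1 - yT. Convergence
always rests on one fact: powers of a quasinilpotent element decay faster than any geometric
sequence. -/

section

variable {A : Type*} [NormedRing A] [NormedAlgebra ℂ A]

/-! ### Quasinilpotent elements and growth of powers -/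

theorem isQuasinilpotent_iff_isUnit {a : A} :
    IsQuasinilpotent a ↔ ∀ l : ℂ, l ≠ 0 → IsUnit (algebraMap ℂ A l - a) := by
  have h : IsQuasinilpotent a ↔ ∀ l ∈ spectrum ℂ a, l = 0 := by
    simp [IsQuasinilpotent, spectralRadius]
  rw [h]
  refine forall_congr' fun l => ?_
  rw [spectrum.mem_iff, ← not_imp_not, not_not]

/-- If `r * s = 0`, then `r + s` is quasinilpotent as soon as `r` and `s` are. -/
theorem IsQuasinilpotent.add_of_mul_eq_zero {r s : A} (hr : IsQuasinilpotent r)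
    (hs : IsQuasinilpotent s) (h : r * s = 0) : IsQuasinilpotent (r + s) := by
  rw [isQuasinilpotent_iff_isUnit] at hr hs ⊢
  intro l hl
  have h1 := (hr l hl).mul (hs l hl)
  have h2 : (algebraMap ℂ A l - r) * (algebraMap ℂ A l - s)
      = algebraMap ℂ A l * (algebraMap ℂ A l - (r + s)) := by
    rw [sub_mul, mul_sub r, h, ← Algebra.commutes l r]
    noncomm_ring
  rw [h2] at h1
  have hu : IsUnit (algebraMap ℂ A l) := (IsUnit.mk0 l hl).map _
  obtain ⟨v, hv⟩ := hu
  rw [← hv] at h1 ⊢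
  exact (Units.isUnit_units_mul v _).1 h1

theorem IsQuasinilpotent.of_sq_eq_zero {a : A} (h : a * a = 0) : IsQuasinilpotent a := by
  rw [isQuasinilpotent_iff_isUnit]
  intro l hl
  have h1 : (algebraMap ℂ A l - a) * (algebraMap ℂ A l + a) = algebraMap ℂ A (l * l) := by
    rw [sub_mul, mul_add, mul_add, h, ← Algebra.commutes l a, map_mul]
    noncomm_ring
  have h2 : (algebraMap ℂ A l + a) * (algebraMap ℂ A l - a) = algebraMap ℂ A (l * l) := by
    rw [add_mul, mul_sub, mul_sub, h, ← Algebra.commutes l a, map_mul]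
    noncomm_ring
  have hc : Commute (algebraMap ℂ A l - a) (algebraMap ℂ A l + a) := h1.trans h2.symm
  exact (hc.isUnit_mul_iff.1 (h1 ▸ (IsUnit.mk0 (l * l) (mul_ne_zero hl hl)).map _)).1

/-- A spectral value l satisfies ‖l‖ ^ n ≤ ‖a ^ n‖ * ‖1‖, which contradicts decay at rate ‖l‖ / 2
unless l = 0. The factor ‖1‖ stays because the norm of the unit is not normalized. -/
theorem isQuasinilpotent_of_norm_pow_le {a : A} [CompleteSpace A]
    (h : ∀ ε : ℝ, 0 < ε → ∃ C : ℝ, ∀ n : ℕ, ‖a ^ n‖ ≤ C * ε ^ n) : IsQuasinilpotent a := by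
  have h' : IsQuasinilpotent a ↔ ∀ l ∈ spectrum ℂ a, l = 0 := by
    simp [IsQuasinilpotent, spectralRadius]
  rw [h']
  intro l hl
  by_contra hl0
  have hpos : 0 < ‖l‖ := norm_pos_iff.2 hl0
  obtain ⟨C, hC⟩ := h (‖l‖ / 2) (by positivity)
  have hb : ∀ n : ℕ, (2 : ℝ) ^ n ≤ C * ‖(1 : A)‖ := fun n => by
    have h1 := spectrum.norm_le_norm_mul_of_mem (spectrum.pow_mem_pow a n hl)
    rw [norm_pow] at h1
    have h2 : ‖l‖ ^ n ≤ C * (‖l‖ / 2) ^ n * ‖(1 : A)‖ :=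
      h1.trans (mul_le_mul_of_nonneg_right (hC n) (norm_nonneg _))
    rw [div_pow] at h2
    have h3 : 0 < ‖l‖ ^ n := by positivity
    have h4 : C * (‖l‖ ^ n / 2 ^ n) * ‖(1 : A)‖ = (C * ‖(1 : A)‖ / 2 ^ n) * ‖l‖ ^ n := by ring
    rw [h4] at h2
    have h5 : 1 ≤ C * ‖(1 : A)‖ / 2 ^ n := by
      by_contra h6
      push Not at h6
      nlinarith
    rwa [le_div_iff₀ (by positivity), one_mul] at h5
  obtain ⟨n, hn⟩ := pow_unbounded_of_one_lt (C * ‖(1 : A)‖) (one_lt_two : (1 : ℝ) < 2)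
  exact absurd (hb n) (not_le.2 hn)

/-- Gelfand's formula gives the bound for large n; the constant absorbs the finitely many others. -/
theorem IsQuasinilpotent.exists_norm_pow_le [CompleteSpace A] {a : A} (ha : IsQuasinilpotent a)
    {ε : ℝ} (hε : 0 < ε) : ∃ C : ℝ, 0 < C ∧ ∀ n : ℕ, ‖a ^ n‖ ≤ C * ε ^ n := by
  have hlim := spectrum.pow_norm_pow_one_div_tendsto_nhds_spectralRadius a
  rw [show spectralRadius ℂ a = 0 from ha] at hlim
  have hO : (fun n : ℕ => a ^ n) =O[Filter.atTop] (fun n : ℕ => ε ^ n) := by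
    refine Asymptotics.IsBigO.of_bound 1 ?_
    filter_upwards [hlim.eventually (gt_mem_nhds (ENNReal.ofReal_pos.2 hε)),
      Filter.eventually_ge_atTop 1] with n hn h1
    have hn' : ‖a ^ n‖ ^ (1 / n : ℝ) < ε := (ENNReal.ofReal_lt_ofReal_iff hε).1 hn
    have h2 : (‖a ^ n‖ ^ (1 / n : ℝ)) ^ n ≤ ε ^ n := pow_le_pow_left₀ (by positivity) hn'.le n
    rw [one_div, Real.rpow_inv_natCast_pow (norm_nonneg _) (by omega)] at h2
    rwa [one_mul, Real.norm_of_nonneg (by positivity)]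
  obtain ⟨C, hC, h⟩ := Asymptotics.bound_of_isBigO_nat_atTop hO
  refine ⟨C, hC, fun n => ?_⟩
  have := h (x := n) (by positivity)
  rwa [Real.norm_of_nonneg (by positivity)] at this

/-- Transfers quasinilpotence to elements whose powers have the shape s * a ^ n * t. The shift of
exponent is what regrouping products such as (y * g * x) ^ (n + 1) produces. -/
theorem IsQuasinilpotent.of_norm_pow_le [CompleteSpace A] {a b : A} (ha : IsQuasinilpotent a)
    {K : ℝ} (h : ∀ n : ℕ, ‖b ^ (n + 1)‖ ≤ K * ‖a ^ n‖) : IsQuasinilpotent b := by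
  have hK : 0 ≤ |K| := abs_nonneg K
  refine isQuasinilpotent_of_norm_pow_le fun ε hε => ?_
  obtain ⟨C, hC, hb⟩ := ha.exists_norm_pow_le hε
  refine ⟨|K| * C / ε + ‖(1 : A)‖, fun n => ?_⟩
  cases n with
  | zero => simp only [pow_zero, mul_one]; linarith [show 0 ≤ |K| * C / ε by positivity]
  | succ n =>
    calc ‖b ^ (n + 1)‖ ≤ K * ‖a ^ n‖ := h n
      _ ≤ |K| * (C * ε ^ n) := mul_le_mul (le_abs_self K) (hb n) (norm_nonneg _) hK
      _ = |K| * C / ε * ε ^ (n + 1) := by field_simp; ring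
      _ ≤ (|K| * C / ε + ‖(1 : A)‖) * ε ^ (n + 1) := by
        gcongr
        linarith [norm_nonneg (1 : A)]

/-- By the binomial theorem, two decay rates ε / 2 add up to ε. -/
theorem IsQuasinilpotent.add_of_commute [CompleteSpace A] {r s : A} (hr : IsQuasinilpotent r)
    (hs : IsQuasinilpotent s) (h : Commute r s) : IsQuasinilpotent (r + s) := by
  refine isQuasinilpotent_of_norm_pow_le fun ε hε => ?_
  obtain ⟨C, hC, hCr⟩ := hr.exists_norm_pow_le (half_pos hε)
  obtain ⟨D, hD, hDs⟩ := hs.exists_norm_pow_le (half_pos hε)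
  refine ⟨C * D, fun n => ?_⟩
  have hsum : ∑ m ∈ Finset.range (n + 1), ((ε / 2) ^ m * (ε / 2) ^ (n - m) * (n.choose m : ℝ))
      = ε ^ n := by
    rw [← add_pow, add_halves]
  rw [h.add_pow, ← hsum, Finset.mul_sum]
  refine norm_sum_le_of_le _ fun m _ => ?_
  rw [← Nat.cast_comm, ← nsmul_eq_mul]
  calc ‖n.choose m • (r ^ m * s ^ (n - m))‖ ≤ n.choose m * ‖r ^ m * s ^ (n - m)‖ := norm_nsmul_le
    _ ≤ n.choose m * ((C * (ε / 2) ^ m) * (D * (ε / 2) ^ (n - m))) := by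
      gcongr
      exact (norm_mul_le _ _).trans (mul_le_mul (hCr m) (hDs _) (norm_nonneg _) (by positivity))
    _ = _ := by ring

/-- The rate 1 / (2 * (‖x‖ + 1)) for the powers of `a` beats the growth of ‖x ^ n‖ and leaves a
geometric series of ratio 1 / 2. Every series below is dominated by this one or by a product of two
such. -/
theorem IsQuasinilpotent.summable_norm_pow_mul_norm_pow [CompleteSpace A] {a : A}
    (ha : IsQuasinilpotent a) (x : A) : Summable fun n : ℕ => ‖a ^ n‖ * ‖x ^ n‖ := by
  set D : ℝ := ‖x‖ + 1 with hD
  have hD0 : 0 < D := by positivity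
  obtain ⟨C, hC, h⟩ := ha.exists_norm_pow_le (show 0 < 1 / (2 * D) by positivity)
  refine Summable.of_nonneg_of_le (fun n => by positivity) (fun n => ?_)
    ((summable_geometric_two).mul_left (C * (‖(1 : A)‖ + 1)))
  have hx : ‖x ^ n‖ ≤ (‖(1 : A)‖ + 1) * D ^ n := by
    rcases Nat.eq_zero_or_pos n with rfl | hn
    · simp
    · calc ‖x ^ n‖ ≤ ‖x‖ ^ n := norm_pow_le' x hn
        _ ≤ D ^ n := pow_le_pow_left₀ (norm_nonneg _) (by linarith) n
        _ ≤ (‖(1 : A)‖ + 1) * D ^ n :=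
          le_mul_of_one_le_left (by positivity) (by linarith [norm_nonneg (1 : A)])
  calc ‖a ^ n‖ * ‖x ^ n‖ ≤ (C * (1 / (2 * D)) ^ n) * ((‖(1 : A)‖ + 1) * D ^ n) :=
        mul_le_mul (h n) hx (norm_nonneg _) (by positivity)
    _ = C * (‖(1 : A)‖ + 1) * ((1 / (2 * D)) * D) ^ n := by rw [mul_pow]; ring
    _ = C * (‖(1 : A)‖ + 1) * (1 / 2) ^ n := by
      congr 2
      field_simp

/-! ### Cline's formula -/

/-- Cline's formula: `y * x` has the generalized Drazin inverse `y * w ^ 2 * x` when `w` is one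
of `x * y`. -/
theorem IsGDrazinInverse.cline [CompleteSpace A] {x y w : A} (h : IsGDrazinInverse (x * y) w) :
    IsGDrazinInverse (y * x) (y * w ^ 2 * x) := by
  have h1 : x * (y * w) = w * (x * y) := by rw [← mul_assoc, h.comm]
  have h2 : w * (w * (x * y)) = w := by rw [← h1, ← mul_assoc x, ← mul_assoc, h.outer]
  have h3 : w * (x * (y * w)) = w := by rw [h1, h2]
  have e1 : y * x * (y * w ^ 2 * x) = y * w * x := by
    calc y * x * (y * w ^ 2 * x) = y * (x * (y * w)) * w * x := by noncomm_ring
      _ = y * (w * (x * y)) * w * x := by rw [h1]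
      _ = y * (w * (x * (y * w))) * x := by simp only [mul_assoc]
      _ = y * w * x := by rw [h3]
  have e2 : y * w ^ 2 * x * (y * x) = y * w * x := by
    calc y * w ^ 2 * x * (y * x) = y * (w * (w * (x * y))) * x := by noncomm_ring
      _ = y * w * x := by rw [h2]
  refine ⟨?_, e1.trans e2.symm, ?_⟩
  · rw [e2]
    calc y * w * x * (y * w ^ 2 * x) = y * (w * (x * (y * w))) * w * x := by noncomm_ring
      _ = y * w ^ 2 * x := by rw [h3]; noncomm_ring
  · set r := x * y - (x * y) ^ 2 * w with hr
    set g := 1 - x * y * w with hg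
    have hgi : g * g = g := by
      have : x * y * w * (x * y * w) = x * y * w := by
        calc x * y * w * (x * y * w) = x * y * (w * (x * (y * w))) := by noncomm_ring
          _ = x * y * w := by rw [h3]
      rw [hg, sub_mul, mul_sub, mul_sub, this]
      simp
    have hq : y * x - (y * x) ^ 2 * (y * w ^ 2 * x) = y * g * x := by
      rw [pow_two (y * x), mul_assoc (y * x), e1, hg]
      noncomm_ring
    have hgr : g * (x * y) = r := by
      rw [hr, hg, sub_mul, h.comm]
      have : w * (x * y) * (x * y) = (x * y) ^ 2 * w := by
        rw [← h.comm, mul_assoc, ← h.comm]; noncomm_ring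
      rw [this, one_mul]
    -- Each inner factor g * (x * y) is r, so the powers inherit the decay of those of r.
    have hpow : ∀ n : ℕ, (y * g * x) ^ (n + 1) = y * (r ^ n * g) * x := by
      intro n
      induction n with
      | zero => simp
      | succ n ih =>
        rw [pow_succ, ih]
        calc y * (r ^ n * g) * x * (y * g * x) = y * (r ^ n * (g * (x * y)) * g) * x := by
              noncomm_ring
          _ = y * (r ^ (n + 1) * g) * x := by rw [hgr, pow_succ]
    have hqn : IsQuasinilpotent r := h.quasinil
    rw [hq]
    refine hqn.of_norm_pow_le (K := ‖y‖ * ‖g‖ * ‖x‖) fun n => ?_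
    rw [hpow]
    calc ‖y * (r ^ n * g) * x‖ ≤ ‖y‖ * (‖r ^ n‖ * ‖g‖) * ‖x‖ :=
          norm_mul_le_of_le (norm_mul_le_of_le le_rfl (norm_mul_le _ _)) le_rfl
      _ = ‖y‖ * ‖g‖ * ‖x‖ * ‖r ^ n‖ := by ring

theorem isGDrazinInvertible_mul_comm [CompleteSpace A] {x y : A} :
    IsGDrazinInvertible (x * y) ↔ IsGDrazinInvertible (y * x) :=
  ⟨fun ⟨_, h⟩ => ⟨_, h.cline⟩, fun ⟨_, h⟩ => ⟨_, h.cline⟩⟩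

/-! ### Sums with a quasinilpotent summand -/

/-- `a + b` has the generalized Drazin inverse `∑ a ^ n * B ^ (n + 1)`; with the facts on it that
are used to expand the powers of `a + b`. -/
theorem IsQuasinilpotent.isGDrazinInverse_add [CompleteSpace A] {a b B f : A}
    (ha : IsQuasinilpotent a) (hb : IsGDrazinInverse b B) (hf : f = 1 - b * B)
    (hba : b * a = f * a * b * f) :
    ∃ T G : A, HasSum (fun n : ℕ => a ^ n * B ^ (n + 1)) T ∧
      HasSum (fun n : ℕ => a ^ (n + 1) * B ^ (n + 1)) G ∧
      IsGDrazinInverse (a + b) T ∧ (a + b) * T = b * B + G ∧ B * a = 0 ∧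
      (∀ k : ℕ, b * (a ^ (k + 1) * B) = 0) ∧
      IsQuasinilpotent (a * f + b * f) ∧
      ∀ n : ℕ, (a + b) ^ n * f = (a * f + b * f) ^ n * f := by
  have hBbB : B * (b * B) = B := by rw [← mul_assoc, hb.outer]
  have hBb : B * b = b * B := hb.comm.symm
  have hBf : B * f = 0 := by rw [hf, mul_sub, hBbB, mul_one, sub_self]
  have hfB : f * B = 0 := by rw [hf, sub_mul, one_mul, hb.comm, hb.outer, sub_self]
  have hff : f * f = f := by
    nth_rw 1 [hf]
    rw [sub_mul, mul_assoc, hBf, mul_zero, sub_zero, one_mul]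
  have hfb : f * b = b * f := by rw [hf, sub_mul, mul_sub, mul_assoc, hBb]; simp
  -- Since B = B * B * b, the product is B * B * (b * a), and b * a starts with f, which B
  -- annihilates.
  have hBa : B * a = 0 := by
    calc B * a = B * B * (b * a) := by
          rw [← mul_assoc, mul_assoc B B b, hBb, hBbB]
      _ = B * (B * f) * a * b * f := by rw [hba]; simp only [mul_assoc]
      _ = 0 := by simp [hBf]
  have hfa : f * a = a := by rw [hf, sub_mul, mul_assoc, hBa]; simp
  have hba' : b * a = a * b * f := by rw [hba, hfa]
  have hbaB : ∀ k : ℕ, b * (a ^ (k + 1) * B) = 0 := by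
    intro k
    induction k with
    | zero => rw [zero_add, pow_one, ← mul_assoc, hba', mul_assoc, hfB, mul_zero]
    | succ k ih =>
      calc b * (a ^ (k + 1 + 1) * B) = b * a * (a ^ (k + 1) * B) := by
            rw [pow_succ' a (k + 1)]; simp only [mul_assoc]
        _ = a * (b * ((f * a) * a ^ k * B)) := by
            rw [hba', pow_succ']; simp only [mul_assoc]
        _ = 0 := by rw [hfa, ← pow_succ', ih, mul_zero]
  have hsum : Summable fun n : ℕ => a ^ n * B ^ (n + 1) := by
    refine Summable.of_norm_bounded ((ha.summable_norm_pow_mul_norm_pow B).mul_right ‖B‖)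
      fun n => ?_
    rw [pow_succ, ← mul_assoc]
    exact norm_mul_le_of_le (norm_mul_le _ _) le_rfl
  obtain ⟨T, hT⟩ := hsum
  have hG : HasSum (fun n : ℕ => a ^ (n + 1) * B ^ (n + 1)) (a * T) := by
    simpa only [pow_succ', mul_assoc] using hT.mul_left a
  have hBpow' : ∀ n : ℕ, B ^ (n + 1) * (b * B) = B ^ (n + 1) := fun n => by
    rw [pow_succ, mul_assoc, hBbB]
  have hbT : b * T = b * B := by
    refine (hT.mul_left b).unique ?_
    convert hasSum_single 0 _ using 1
    · simp
    · intro n hn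
      obtain ⟨m, rfl⟩ := Nat.exists_eq_succ_of_ne_zero hn
      rw [Nat.succ_eq_add_one, pow_succ' B (m + 1), ← mul_assoc (a ^ (m + 1)), ← mul_assoc b,
        hbaB, zero_mul]
  have hTa : T * a = 0 := by
    refine (hT.mul_right a).unique ?_
    convert hasSum_zero with n
    rw [pow_succ, mul_assoc, mul_assoc, hBa, mul_zero, mul_zero]
  have hTf : T * f = 0 := by
    refine (hT.mul_right f).unique ?_
    convert hasSum_zero with n
    rw [pow_succ, mul_assoc, mul_assoc, hBf, mul_zero, mul_zero]
  have hTbB : T * (b * B) = T := by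
    have h := hTf
    rw [hf, mul_sub, mul_one, sub_eq_zero] at h
    exact h.symm
  have hTb : T * b = b * B + a * T := by
    have hS : HasSum (fun n : ℕ => a ^ (n + 1) * B ^ (n + 1 + 1) * b) (a * T) := by
      have h : ∀ n : ℕ, a ^ (n + 1) * B ^ (n + 1 + 1) * b = a ^ (n + 1) * B ^ (n + 1) := fun n => by
        rw [mul_assoc, pow_succ B (n + 1), mul_assoc (B ^ (n + 1)), hBb, hBpow']
      simpa only [h] using hG
    have h := (hT.mul_right b).unique (HasSum.zero_add hS)
    simpa [hBb] using h
  have hbaT : b * (a * T) = 0 := by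
    refine (hG.mul_left b).unique ?_
    convert hasSum_zero with n
    rw [pow_succ' B, ← mul_assoc (a ^ (n + 1)), ← mul_assoc b, hbaB, zero_mul]
  have habT : (a + b) * T = b * B + a * T := by rw [add_mul, hbT, add_comm]
  have hTab : T * (a + b) = b * B + a * T := by rw [mul_add, hTa, zero_add, hTb]
  have hk : (a + b) * f = a * f + b * f := add_mul _ _ _
  have hfk : f * (a * f + b * f) = a * f + b * f := by
    rw [mul_add, ← mul_assoc, ← mul_assoc, hfa, hfb, mul_assoc, hff]
  have haf : IsQuasinilpotent (a * f) := by
    refine ha.of_norm_pow_le (K := ‖a‖ * ‖f‖) fun n => ?_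
    have : (a * f) ^ (n + 1) = a * a ^ n * f := by
      induction n with
      | zero => simp
      | succ n ih =>
        rw [pow_succ, ih, pow_succ a n]
        calc a * a ^ n * f * (a * f) = a * a ^ n * (f * a) * f := by simp only [mul_assoc]
          _ = _ := by rw [hfa]; simp only [mul_assoc]
    rw [this]
    calc ‖a * a ^ n * f‖ ≤ ‖a‖ * ‖a ^ n‖ * ‖f‖ := norm_mul_le_of_le (norm_mul_le _ _) le_rfl
      _ = _ := by ring
  have hbf : IsQuasinilpotent (b * f) := by
    have h : b * f = b - b ^ 2 * B := by rw [hf]; noncomm_ring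
    rw [h]
    exact hb.quasinil
  have hcomm : Commute (a * f) (b * f) := by
    change a * f * (b * f) = b * f * (a * f)
    calc a * f * (b * f) = a * (f * b) * f := by simp only [mul_assoc]
      _ = a * b * (f * f) := by rw [hfb]; simp only [mul_assoc]
      _ = a * b * (f * f) * f := by rw [hff, mul_assoc _ f, hff]
      _ = b * (f * a) * f := by rw [hff, ← hba', hfa]
      _ = b * f * (a * f) := by simp only [mul_assoc]
  have hkq := haf.add_of_commute hbf hcomm
  refine ⟨T, a * T, hT, hG, ⟨?_, habT.trans hTab.symm, ?_⟩, habT, hBa, hbaB, hkq, ?_⟩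
  · rw [mul_assoc, habT, mul_add, hTbB, ← mul_assoc, hTa, zero_mul, add_zero]
  -- Because T * a = 0 and T * f = 0, the first summand squares to zero and annihilates the second
  -- from the left.
  · have h1 : a + b - (a + b) ^ 2 * T = -(a * (a * T)) + (a * f + b * f) := by
      have h2 : (a + b) ^ 2 * T = a * (b * B) + b * (b * B) + a * (a * T) := by
        rw [pow_two, mul_assoc, habT, mul_add, add_mul, add_mul, hbaT, add_zero]
      rw [h2, hf]
      noncomm_ring
    rw [h1]
    refine IsQuasinilpotent.add_of_mul_eq_zero (.of_sq_eq_zero ?_) hkq ?_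
    · rw [neg_mul_neg]
      simp only [mul_assoc]
      rw [← mul_assoc T a, hTa]
      simp
    · rw [neg_mul, mul_add, ← hfb]
      simp only [mul_assoc]
      rw [← mul_assoc T a, hTa, ← mul_assoc T f, hTf]
      simp
  · intro n
    induction n with
    | zero => simp
    | succ n ih =>
      rw [pow_succ, mul_assoc, hk, ← hfk, ← mul_assoc, ih, mul_assoc, hfk, pow_succ, mul_assoc,
        add_mul, mul_assoc, mul_assoc b, hff]

/-! ### Intertwining and compression to invariant blocks -/

theorem IsQuasinilpotent.eq_zero_of_norm_le [CompleteSpace A] {a x z : A}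
    (ha : IsQuasinilpotent a) {K : ℝ}
    (h : ∀ n : ℕ, 1 ≤ n → ‖z‖ ≤ ‖a ^ n‖ * ‖x ^ n‖ * K) : z = 0 := by
  have hlim := ((ha.summable_norm_pow_mul_norm_pow x).tendsto_atTop_zero).mul_const K
  rw [zero_mul] at hlim
  exact norm_le_zero_iff.1 (ge_of_tendsto hlim (Filter.eventually_atTop.2 ⟨1, h⟩))

theorem IsGDrazinInverse.pow_mul_pow {a x : A} (h : IsGDrazinInverse a x) (n : ℕ) :
    a ^ (n + 1) * x ^ (n + 1) = a * x := by
  have hi : IsIdempotentElem (a * x) := by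
    change a * x * (a * x) = a * x
    rw [mul_assoc, ← mul_assoc x, h.outer]
  rw [← Commute.mul_pow h.comm, hi.pow_succ_eq]

theorem IsGDrazinInverse.pow_sub {a x : A} (h : IsGDrazinInverse a x) (n : ℕ) :
    (a - a ^ 2 * x) ^ (n + 1) = a ^ (n + 1) * (1 - a * x) := by
  have hi : IsIdempotentElem (1 - a * x) := by
    refine IsIdempotentElem.one_sub ?_
    change a * x * (a * x) = a * x
    rw [mul_assoc, ← mul_assoc x, h.outer]
  have hc : Commute a (1 - a * x) :=
    (Commute.one_right a).sub_right ((Commute.refl a).mul_right h.comm)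
  have h1 : a - a ^ 2 * x = a * (1 - a * x) := by noncomm_ring
  rw [h1, hc.mul_pow, hi.pow_succ_eq]

/-- Generalized Drazin inverses respect intertwining elements. -/
theorem IsGDrazinInverse.intertwine [CompleteSpace A] {w W y Y u : A}
    (hw : IsGDrazinInverse w W) (hy : IsGDrazinInverse y Y) (h : y * u = u * w) :
    Y * u = u * W := by
  have hn : ∀ n : ℕ, y ^ n * u = u * w ^ n := fun n =>
    (SemiconjBy.pow_right (show SemiconjBy u w y from h.symm) n).eq.symm
  -- Insert w ^ n * W ^ n before W and move w ^ n across u: it becomes y ^ n, and 1 - y * Y turns it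
  -- into a power of the quasinilpotent part of y.
  have h1 : (1 - y * Y) * u * W = 0 := by
    refine IsQuasinilpotent.eq_zero_of_norm_le hy.quasinil (x := W) (K := ‖u‖ * ‖W‖) fun n hn1 => ?_
    obtain ⟨m, rfl⟩ := Nat.exists_eq_succ_of_ne_zero (Nat.one_le_iff_ne_zero.1 hn1)
    have hc : Commute (y ^ (m + 1)) (1 - y * Y) :=
      ((Commute.one_right y).sub_right ((Commute.refl y).mul_right hy.comm)).pow_left _
    have e : (1 - y * Y) * u * W = (y - y ^ 2 * Y) ^ (m + 1) * (u * (W ^ (m + 1) * W)) := by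
      calc (1 - y * Y) * u * W = (1 - y * Y) * u * (w * W * W) := by
            rw [hw.comm, hw.outer]
        _ = (1 - y * Y) * (u * w ^ (m + 1)) * (W ^ (m + 1) * W) := by
            rw [← hw.pow_mul_pow m]; simp only [mul_assoc]
        _ = _ := by rw [← hn, hy.pow_sub, hc.eq]; simp only [mul_assoc]
    rw [e]
    calc ‖(y - y ^ 2 * Y) ^ (m + 1) * (u * (W ^ (m + 1) * W))‖
        ≤ ‖(y - y ^ 2 * Y) ^ (m + 1)‖ * (‖u‖ * (‖W ^ (m + 1)‖ * ‖W‖)) :=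
          norm_mul_le_of_le le_rfl (norm_mul_le_of_le le_rfl (norm_mul_le _ _))
      _ = _ := by rw [Nat.succ_eq_add_one]; ring
  have h2 : Y * u * (1 - w * W) = 0 := by
    refine IsQuasinilpotent.eq_zero_of_norm_le hw.quasinil (x := Y) (K := ‖u‖ * ‖Y‖) fun n hn1 => ?_
    obtain ⟨m, rfl⟩ := Nat.exists_eq_succ_of_ne_zero (Nat.one_le_iff_ne_zero.1 hn1)
    have hc : Commute (y ^ (m + 1)) (Y ^ (m + 1)) := Commute.pow_pow hy.comm _ _
    have e : Y * u * (1 - w * W) = Y * Y ^ (m + 1) * u * (w - w ^ 2 * W) ^ (m + 1) := by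
      calc Y * u * (1 - w * W) = Y * (y * Y) * u * (1 - w * W) := by
            rw [← mul_assoc Y y Y, hy.outer]
        _ = Y * Y ^ (m + 1) * (y ^ (m + 1) * u) * (1 - w * W) := by
            rw [← hy.pow_mul_pow m, hc.eq]; simp only [mul_assoc]
        _ = _ := by rw [hn, hw.pow_sub]; simp only [mul_assoc]
    rw [e]
    calc ‖Y * Y ^ (m + 1) * u * (w - w ^ 2 * W) ^ (m + 1)‖
        ≤ ‖Y‖ * ‖Y ^ (m + 1)‖ * ‖u‖ * ‖(w - w ^ 2 * W) ^ (m + 1)‖ :=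
          norm_mul_le_of_le (norm_mul_le_of_le (norm_mul_le _ _) le_rfl) le_rfl
      _ = _ := by rw [Nat.succ_eq_add_one]; ring
  have h3 : u * W = y * Y * u * W := by
    rwa [sub_mul, sub_mul, one_mul, sub_eq_zero] at h1
  have h4 : Y * u = Y * u * (w * W) := by
    rwa [mul_sub, mul_one, sub_eq_zero] at h2
  rw [h4, h3, hy.comm, ← mul_assoc, mul_assoc Y u w, ← h, ← mul_assoc]

/-- The restriction of `w` to a subspace `p` invariant under `w` and its inverse. -/
theorem IsGDrazinInverse.mul_right_of_invariant [CompleteSpace A] {w W p : A}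
    (hw : IsGDrazinInverse w W) (h : p * w * p = w * p) (hW : p * W * p = W * p) :
    IsGDrazinInverse (w * p) (W * p) := by
  have key : ∀ t s : A, p * s * p = s * p → t * p * (s * p) = t * s * p := fun t s hs => by
    rw [mul_assoc, ← mul_assoc p, hs, mul_assoc]
  have inv : ∀ t s : A, p * t * p = t * p → p * s * p = s * p → p * (t * s) * p = t * s * p :=
    fun t s ht hs => by
      rw [mul_assoc p, ← key t s hs, ← mul_assoc p, ← mul_assoc p, ht]
  have hr : p * (w - w ^ 2 * W) * p = (w - w ^ 2 * W) * p := by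
    rw [mul_sub, sub_mul, sub_mul, h, inv _ _ (by rw [pow_two, inv _ _ h h]) hW]
  have hpow : ∀ n : ℕ, ((w - w ^ 2 * W) * p) ^ (n + 1) = (w - w ^ 2 * W) ^ (n + 1) * p := by
    intro n
    induction n with
    | zero => simp
    | succ n ih => rw [pow_succ, ih, key _ _ hr, ← pow_succ]
  refine ⟨?_, by rw [key _ _ hW, key _ _ h, hw.comm], ?_⟩
  · rw [key _ _ h, key _ _ hW, hw.outer]
  · rw [pow_two, key _ _ h, key _ _ hW, ← sub_mul, ← pow_two]
    refine IsQuasinilpotent.of_norm_pow_le hw.quasinil (K := ‖w - w ^ 2 * W‖ * ‖p‖) fun n => ?_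
    rw [hpow, pow_succ]
    calc ‖(w - w ^ 2 * W) ^ n * (w - w ^ 2 * W) * p‖
        ≤ ‖(w - w ^ 2 * W) ^ n‖ * ‖w - w ^ 2 * W‖ * ‖p‖ :=
          norm_mul_le_of_le (norm_mul_le _ _) le_rfl
      _ = _ := by ring

/-- Mirror image of `IsGDrazinInverse.mul_right_of_invariant` under reversal of products. For u = 1
- p it describes the block induced on the quotient. -/
theorem IsGDrazinInverse.mul_left_of_invariant [CompleteSpace A] {w W u : A}
    (hw : IsGDrazinInverse w W) (h : u * w * u = u * w) (hW : u * W * u = u * W) :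
    IsGDrazinInverse (u * w) (u * W) := by
  have key : ∀ t s : A, u * t * u = u * t → u * t * (u * s) = u * (t * s) := fun t s ht => by
    rw [← mul_assoc, ht, mul_assoc]
  have inv : ∀ t s : A, u * t * u = u * t → u * s * u = u * s → u * (t * s) * u = u * (t * s) :=
    fun t s ht hs => by
      rw [← key t s ht, mul_assoc (u * t), hs]
  have hr : u * (w - w ^ 2 * W) * u = u * (w - w ^ 2 * W) := by
    rw [mul_sub, sub_mul, h, inv _ _ (by rw [pow_two, inv _ _ h h]) hW]
  have hpow : ∀ n : ℕ, (u * (w - w ^ 2 * W)) ^ (n + 1) = u * (w - w ^ 2 * W) ^ (n + 1) := by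
    intro n
    induction n with
    | zero => simp
    | succ n ih => rw [pow_succ', ih, key _ _ hr, ← pow_succ']
  refine ⟨?_, by rw [key _ _ h, key _ _ hW, hw.comm], ?_⟩
  · rw [key _ _ hW, key _ _ (inv _ _ hW h), hw.outer]
  · rw [pow_two, key _ _ h, key _ _ (inv _ _ h h), ← mul_sub, ← pow_two]
    refine IsQuasinilpotent.of_norm_pow_le hw.quasinil (K := ‖u‖ * ‖w - w ^ 2 * W‖) fun n => ?_
    rw [hpow, pow_succ']
    calc ‖u * ((w - w ^ 2 * W) * (w - w ^ 2 * W) ^ n)‖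
        ≤ ‖u‖ * (‖w - w ^ 2 * W‖ * ‖(w - w ^ 2 * W) ^ n‖) :=
          norm_mul_le_of_le le_rfl (norm_mul_le _ _)
      _ = _ := by ring

/-! ### Block triangular elements -/

/-- The algebraic half of the triangular formula: the series S and R enter only through relations,
of which `hS1` and `hS2` arise by splitting off a term with n = 0. The corner Q = S + R - X * z * Y
then satisfies the Sylvester equation x * Q + z * Y = X * z + Q * y, which is commutation. -/
theorem IsGDrazinInverse.triangular_of_identities {x y z X Y S R : A}
    (hx : IsGDrazinInverse x X) (hy : IsGDrazinInverse y Y)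
    (hxy : x * y = 0) (hyx : y * x = 0) (hzx : z * x = 0) (hyz : y * z = 0) (hzz : z * z = 0)
    (hS1 : x * S = X * z * (1 - y * Y) + S * y) (hS2 : x * R + (1 - x * X) * z * Y = R * y)
    (hS3 : X * (x * S) = S) (hR3 : R * (y * Y) = R) (hxR : X * (x * R) = 0)
    (hSY : S * (y * Y) = 0)
    (hSx : S * x = 0) (hSz : S * z = 0) (hyS : y * S = 0) (hzS : z * S = 0)
    (hRx : R * x = 0) (hRz : R * z = 0) (hyR : y * R = 0) (hzR : z * R = 0) :
    IsGDrazinInverse (x + y + z) (X + Y + (S + R - X * z * Y)) := by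
  have hXX : X * (X * x) = X := by rw [← hx.comm, ← mul_assoc, hx.outer]
  have hXX' : x * (X * X) = X := by rw [← mul_assoc, hx.comm, hx.outer]
  have hYY : Y * (Y * y) = Y := by rw [← hy.comm, ← mul_assoc, hy.outer]
  have hYY' : y * (Y * Y) = Y := by rw [← mul_assoc, hy.comm, hy.outer]
  have hyX : y * X = 0 := by rw [← hXX', ← mul_assoc, hyx, zero_mul]
  have hzX : z * X = 0 := by rw [← hXX', ← mul_assoc, hzx, zero_mul]
  have hxY : x * Y = 0 := by rw [← hYY', ← mul_assoc, hxy, zero_mul]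
  have hYx : Y * x = 0 := by rw [← hYY, mul_assoc, mul_assoc, hyx, mul_zero, mul_zero]
  have hYz : Y * z = 0 := by rw [← hYY, mul_assoc, mul_assoc, hyz, mul_zero, mul_zero]
  have hXy : X * y = 0 := by rw [← hXX, mul_assoc, mul_assoc, hxy, mul_zero, mul_zero]
  set Q := S + R - X * z * Y with hQ
  have hQx : Q * x = 0 := by
    rw [hQ, sub_mul, add_mul, hSx, hRx, mul_assoc, hYx, mul_zero]; simp
  have hQz : Q * z = 0 := by
    rw [hQ, sub_mul, add_mul, hSz, hRz, mul_assoc, hYz, mul_zero]; simp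
  have hyQ : y * Q = 0 := by
    rw [hQ, mul_sub, mul_add, hyS, hyR, ← mul_assoc, ← mul_assoc, hyX]; simp
  have hzQ : z * Q = 0 := by
    rw [hQ, mul_sub, mul_add, hzS, hzR, ← mul_assoc, ← mul_assoc, hzX]; simp
  have hQc : x * Q + z * Y = X * z + Q * y := by
    have h1 : X * z * Y * y = X * z * (y * Y) := by rw [mul_assoc, hy.comm]
    rw [hQ, sub_mul, add_mul, ← hS2, h1, mul_sub, mul_add, hS1]
    noncomm_ring
  have hQXY : X * (x * Q) + X * (z * Y) + Q * (y * Y) = Q := by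
    have h1 : X * (x * (X * z * Y)) = X * z * Y := by
      calc X * (x * (X * z * Y)) = X * x * X * z * Y := by simp only [mul_assoc]
        _ = _ := by rw [hx.outer]
    have h2 : X * z * Y * (y * Y) = X * z * Y := by
      rw [mul_assoc, ← mul_assoc Y, hy.outer]
    rw [hQ, sub_mul, add_mul, hSY, hR3, h2, mul_sub, mul_sub, mul_add, mul_add, hS3, hxR, h1]
    noncomm_ring
  clear_value Q
  clear hQ hS1 hS2 hS3 hR3 hxR hSY hSx hSz hyS hzS hRx hRz hyR hzR
  have hr : (x + y + z) * (X + Y + Q) = x * X + y * Y + (x * Q + z * Y) := by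
    simp only [add_mul, mul_add, hxY, hyX, hyQ, hzX, hzQ]
    abel
  have hl : (X + Y + Q) * (x + y + z) = x * X + y * Y + (X * z + Q * y) := by
    simp only [add_mul, mul_add, hXy, hYx, hYz, hQx, hQz, ← hx.comm, ← hy.comm]
    abel
  have a0 : ∀ {s t : A}, s * t = 0 → ∀ v, s * (t * v) = 0 := fun h v => by
    rw [← mul_assoc, h, zero_mul]
  refine ⟨?_, by rw [hr, hl, hQc], ?_⟩
  · rw [mul_assoc, hr]
    have e : (X + Y + Q) * (x * X + y * Y + (x * Q + z * Y))
        = X * x * X + Y * y * Y + (X * (x * Q) + X * (z * Y) + Q * (y * Y)) := by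
      simp only [add_mul, mul_add, a0 hYx, a0 hYz, a0 hXy, a0 hQx, a0 hQz, mul_assoc]
      abel
    rw [e, hx.outer, hy.outer, hQXY]
  -- The off-diagonal corner t of the residue squares to zero. In the order y-part, t, x-part the
  -- products vanish, so quasinilpotence adds up.
  · set t := z - x * (x * Q + z * Y) - z * (y * Y) with ht
    have e : x + y + z - (x + y + z) ^ 2 * (X + Y + Q)
        = ((y - y ^ 2 * Y) + t) + (x - x ^ 2 * X) := by
      rw [pow_two, mul_assoc, hr, ht]
      simp only [add_mul, mul_add, a0 hxy, a0 hyx, a0 hzx, a0 hyz, a0 hzz, pow_two, mul_assoc]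
      abel
    have hyt : y * t = 0 := by
      rw [ht]; simp [mul_sub, mul_add, hyz, a0 hyx, a0 hyz]
    have htx : t * x = 0 := by
      rw [ht]; simp [sub_mul, mul_assoc, add_mul, hzx, hQx, hYx]
    have htz : t * z = 0 := by
      rw [ht]; simp [sub_mul, mul_assoc, add_mul, hzz, hQz, hYz]
    have htt : t * t = 0 := by
      nth_rw 2 [ht]
      simp [mul_sub, mul_add, htz, a0 htz, a0 htx]
    have hY' : y - y ^ 2 * Y = y - Y * (y * y) := by
      rw [pow_two, mul_assoc, hy.comm, ← mul_assoc, hy.comm, mul_assoc]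
    rw [e]
    refine IsQuasinilpotent.add_of_mul_eq_zero (IsQuasinilpotent.add_of_mul_eq_zero hy.quasinil
      (.of_sq_eq_zero htt) ?_) hx.quasinil ?_
    · rw [hY']
      simp [sub_mul, mul_assoc, hyt]
    · rw [hY', pow_two, mul_assoc x]
      simp [add_mul, sub_mul, mul_sub, mul_assoc, htx, hyx, a0 htx, a0 hyx]

end

theorem HasSum.mul_right_eq_zero {M : Type*} [NormedRing M] {f : ℕ → M} {s v : M}
    (hs : HasSum f s) (h : ∀ n, f n * v = 0) : s * v = 0 :=
  (hs.mul_right v).unique (by simpa only [h] using hasSum_zero)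

theorem HasSum.mul_left_eq_zero {M : Type*} [NormedRing M] {f : ℕ → M} {s v : M}
    (hs : HasSum f s) (h : ∀ n, v * f n = 0) : v * s = 0 :=
  (hs.mul_left v).unique (by simpa only [h] using hasSum_zero)

section

variable {A : Type*} [NormedRing A] [NormedAlgebra ℂ A]

/-- Next to the spectral idempotent, powers of `a` may be replaced by powers of its quasinilpotent
part. Keeping the idempotent on both sides makes this valid for n = 0. -/
theorem IsGDrazinInverse.pow_mul_one_sub {a x : A} (h : IsGDrazinInverse a x) (n : ℕ) :
    a ^ n * (1 - a * x) = (a - a ^ 2 * x) ^ n * (1 - a * x) ∧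
    (1 - a * x) * a ^ n = (1 - a * x) * (a - a ^ 2 * x) ^ n := by
  have hi : IsIdempotentElem (1 - a * x) := by
    refine IsIdempotentElem.one_sub ?_
    change a * x * (a * x) = a * x
    rw [mul_assoc, ← mul_assoc x, h.outer]
  have hc : Commute a (1 - a * x) :=
    (Commute.one_right a).sub_right ((Commute.refl a).mul_right h.comm)
  cases n with
  | zero => simp
  | succ n =>
    rw [h.pow_sub, mul_assoc, hi.eq, ← mul_assoc, ← (hc.pow_left _).eq, mul_assoc, hi.eq]
    exact ⟨rfl, rfl⟩

/-- The generalized Drazin inverse of a block triangular element `x + y + z`. -/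
theorem IsGDrazinInverse.triangular [CompleteSpace A] {x y z X Y : A}
    (hx : IsGDrazinInverse x X) (hy : IsGDrazinInverse y Y)
    (hxy : x * y = 0) (hyx : y * x = 0) (hzx : z * x = 0) (hyz : y * z = 0) (hzz : z * z = 0) :
    ∃ S R : A, HasSum (fun n : ℕ => X ^ (n + 2) * z * y ^ n * (1 - y * Y)) S ∧
      HasSum (fun n : ℕ => (1 - x * X) * x ^ n * z * Y ^ (n + 2)) R ∧
      IsGDrazinInverse (x + y + z) (X + Y + (S + R - X * z * Y)) := by
  have hXX' : x * (X * X) = X := by rw [← mul_assoc, hx.comm, hx.outer]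
  have hYY : Y * (Y * y) = Y := by rw [← hy.comm, ← mul_assoc, hy.outer]
  have hyX : y * X = 0 := by rw [← hXX', ← mul_assoc, hyx, zero_mul]
  have hzX : z * X = 0 := by rw [← hXX', ← mul_assoc, hzx, zero_mul]
  have hYx : Y * x = 0 := by rw [← hYY, mul_assoc, mul_assoc, hyx, mul_zero, mul_zero]
  have hYz : Y * z = 0 := by rw [← hYY, mul_assoc, mul_assoc, hyz, mul_zero, mul_zero]
  have hSs : Summable fun n : ℕ => X ^ (n + 2) * z * y ^ n * (1 - y * Y) := by
    refine Summable.of_norm_bounded (((show IsQuasinilpotent (y - y ^ 2 * Y) from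
      hy.quasinil).summable_norm_pow_mul_norm_pow X).mul_left (‖X ^ 2 * z‖ * ‖1 - y * Y‖))
      fun n => ?_
    rw [mul_assoc, (hy.pow_mul_one_sub n).1, pow_add, mul_assoc (X ^ n)]
    calc ‖X ^ n * (X ^ 2 * z) * ((y - y ^ 2 * Y) ^ n * (1 - y * Y))‖
        ≤ ‖X ^ n‖ * ‖X ^ 2 * z‖ * (‖(y - y ^ 2 * Y) ^ n‖ * ‖1 - y * Y‖) :=
          norm_mul_le_of_le (norm_mul_le _ _) (norm_mul_le _ _)
      _ = _ := by ring
  have hRs : Summable fun n : ℕ => (1 - x * X) * x ^ n * z * Y ^ (n + 2) := by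
    refine Summable.of_norm_bounded (((show IsQuasinilpotent (x - x ^ 2 * X) from
      hx.quasinil).summable_norm_pow_mul_norm_pow Y).mul_left (‖1 - x * X‖ * ‖z‖ * ‖Y ^ 2‖))
      fun n => ?_
    rw [(hx.pow_mul_one_sub n).2, pow_add]
    calc ‖(1 - x * X) * (x - x ^ 2 * X) ^ n * z * (Y ^ n * Y ^ 2)‖
        ≤ ‖1 - x * X‖ * ‖(x - x ^ 2 * X) ^ n‖ * ‖z‖ * (‖Y ^ n‖ * ‖Y ^ 2‖) :=
          norm_mul_le_of_le (norm_mul_le_of_le (norm_mul_le _ _) le_rfl) (norm_mul_le _ _)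
      _ = _ := by ring
  obtain ⟨S, hS⟩ := hSs
  obtain ⟨R, hR⟩ := hRs
  have kill : ∀ v : A, y * v = 0 → Y * v = 0 → z * v = 0 → S * v = 0 := fun v h1 h2 h3 => by
    refine hS.mul_right_eq_zero fun n => ?_
    have h4 : (1 - y * Y) * v = v := by rw [sub_mul, mul_assoc, h2]; simp
    rw [mul_assoc _ (1 - y * Y), h4]
    cases n with
    | zero => simp [mul_assoc, h3]
    | succ n => simp [pow_succ, mul_assoc, h1]
  have kill' : ∀ v : A, v * x = 0 → v * z = 0 → v * R = 0 := fun v h1 h2 => by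
    refine hR.mul_left_eq_zero fun n => ?_
    have h4 : v * (1 - x * X) = v := by rw [mul_sub, ← mul_assoc, h1]; simp
    rw [← mul_assoc, ← mul_assoc, ← mul_assoc, h4]
    cases n with
    | zero => simp [h2]
    | succ n => rw [pow_succ', ← mul_assoc, h1]; simp
  have hyc : (1 - y * Y) * y = y * (1 - y * Y) := by
    rw [sub_mul, mul_sub, mul_assoc, ← hy.comm]; simp
  have hxc : x * (1 - x * X) = (1 - x * X) * x := by
    rw [sub_mul, mul_sub, mul_assoc, ← hx.comm]; simp
  refine ⟨S, R, hS, hR, hx.triangular_of_identities hy hxy hyx hzx hyz hzz ?_ ?_ ?_ ?_ ?_ ?_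
    (kill x hyx hYx hzx) (kill z hyz hYz hzz) ?_ ?_ ?_ ?_ (kill' y hyx hyz) (kill' z hzx hzz)⟩
  · have h1 : HasSum (fun n : ℕ => X ^ (n + 1) * z * y ^ n * (1 - y * Y)) (x * S) := by
      have e : ∀ n : ℕ, x * (X ^ (n + 2) * z * y ^ n * (1 - y * Y))
          = X ^ (n + 1) * z * y ^ n * (1 - y * Y) := fun n => by
        calc x * (X ^ (n + 2) * z * y ^ n * (1 - y * Y))
            = x * (X * X) * X ^ n * z * y ^ n * (1 - y * Y) := by
              rw [add_comm n 2, pow_add, pow_two]; simp only [mul_assoc]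
          _ = _ := by rw [hXX', ← pow_succ']
      simpa only [e] using hS.mul_left x
    have h2 : HasSum (fun n : ℕ => X ^ (n + 1 + 1) * z * y ^ (n + 1) * (1 - y * Y)) (S * y) := by
      have e : ∀ n : ℕ, X ^ (n + 2) * z * y ^ n * (1 - y * Y) * y
          = X ^ (n + 1 + 1) * z * y ^ (n + 1) * (1 - y * Y) := fun n => by
        rw [mul_assoc, hyc, pow_succ y]; simp only [mul_assoc]
      simpa only [e] using hS.mul_right y
    simpa using h1.unique
      (HasSum.zero_add (f := fun n : ℕ => X ^ (n + 1) * z * y ^ n * (1 - y * Y)) h2)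
  · have h1 : HasSum (fun n : ℕ => (1 - x * X) * x ^ n * z * Y ^ (n + 1)) (R * y) := by
      have e : ∀ n : ℕ, (1 - x * X) * x ^ n * z * Y ^ (n + 2) * y
          = (1 - x * X) * x ^ n * z * Y ^ (n + 1) := fun n => by
        rw [pow_succ Y (n + 1), pow_succ Y n]
        simp only [mul_assoc, hYY]
      simpa only [e] using hR.mul_right y
    have h2 : HasSum (fun n : ℕ => (1 - x * X) * x ^ (n + 1) * z * Y ^ (n + 1 + 1)) (x * R) := by
      have e : ∀ n : ℕ, x * ((1 - x * X) * x ^ n * z * Y ^ (n + 2))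
          = (1 - x * X) * x ^ (n + 1) * z * Y ^ (n + 1 + 1) := fun n => by
        rw [pow_succ' x n, ← mul_assoc (1 - x * X), ← hxc]; simp only [mul_assoc]
      simpa only [e] using hR.mul_left x
    have h3 := h1.unique
      (HasSum.zero_add (f := fun n : ℕ => (1 - x * X) * x ^ n * z * Y ^ (n + 1)) h2)
    rw [h3, add_comm]
    simp
  · rw [← mul_assoc]
    refine (hS.mul_left (X * x)).unique ?_
    have e : ∀ n : ℕ, X * x * (X ^ (n + 2) * z * y ^ n * (1 - y * Y))
        = X ^ (n + 2) * z * y ^ n * (1 - y * Y) := fun n => by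
      simp only [← mul_assoc]
      rw [pow_succ' X (n + 1), ← mul_assoc, hx.outer]
    simpa only [e] using hS
  · refine (hR.mul_right (y * Y)).unique ?_
    have e : ∀ n : ℕ, (1 - x * X) * x ^ n * z * Y ^ (n + 2) * (y * Y)
        = (1 - x * X) * x ^ n * z * Y ^ (n + 2) := fun n => by
      rw [pow_succ Y (n + 1), mul_assoc, mul_assoc (Y ^ (n + 1)), ← mul_assoc Y y, hy.outer]
    simpa only [e] using hR
  · rw [← mul_assoc]
    refine hR.mul_left_eq_zero fun n => ?_
    have h : X * x * (1 - x * X) = 0 := by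
      rw [hx.comm, mul_sub, mul_one, ← mul_assoc, hx.outer, sub_self]
    simp only [← mul_assoc, h, zero_mul]
  · refine hS.mul_right_eq_zero fun n => ?_
    have h : (1 - y * Y) * (y * Y) = 0 := by
      rw [sub_mul, one_mul, mul_assoc, ← mul_assoc Y, hy.outer, sub_self]
    rw [mul_assoc, h, mul_zero]
  · refine hS.mul_left_eq_zero fun n => ?_
    simp only [← mul_assoc]
    rw [pow_succ', ← mul_assoc, hyX]; simp
  · refine hS.mul_left_eq_zero fun n => ?_
    simp only [← mul_assoc]
    rw [pow_succ', ← mul_assoc, hzX]; simp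
  · refine hR.mul_right_eq_zero fun n => ?_
    rw [pow_succ]; simp only [mul_assoc, hYx, mul_zero]
  · refine hR.mul_right_eq_zero fun n => ?_
    rw [pow_succ]; simp only [mul_assoc, hYz, mul_zero]

/-- `u * b` and `u * b ^ d` for a block triangular `b` one of whose diagonal blocks is
generalized Drazin invertible. -/
theorem IsGDrazinInverse.mul_left_of_triangular [CompleteSpace A] {b B p u : A}
    (hb : IsGDrazinInverse b B) (hpu : p + u = 1) (huu : u * u = u) (hup : u * p = 0)
    (hubp : u * b * p = 0)
    (h : IsGDrazinInvertible (u * b) ∨ IsGDrazinInvertible (b * p)) :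
    u * B * u = u * B ∧ IsGDrazinInverse (u * b) (u * B) := by
  have hu : ∀ t : A, u * t * p = 0 → u * t * u = u * t := fun t ht => by
    calc u * t * u = u * t * p + u * t * u := by rw [ht, zero_add]
      _ = u * t := by rw [← mul_add, hpu, mul_one]
  have hB : u * B * u = u * B := by
    -- Either block suffices: u intertwines b with u * b, and p intertwines b * p with b.
    rcases h with ⟨Y, hY⟩ | ⟨X, hX⟩
    · have h1 : Y * u = u * B := hb.intertwine hY (hu b hubp)
      rw [← h1, mul_assoc, huu]
    · have h1 : b * p = p * (b * p) := by
        calc b * p = p * (b * p) + u * b * p := by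
              rw [mul_assoc u, ← add_mul, hpu, one_mul]
          _ = _ := by rw [hubp, add_zero]
      have h2 := hX.intertwine hb h1
      exact hu B (by rw [mul_assoc, h2, ← mul_assoc, hup, zero_mul])
  exact ⟨hB, hb.mul_left_of_invariant (hu b hubp) hB⟩

end

/-! ### The equivalences and the formula -/

theorem corollary2p6 {A : Type*} [NormedRing A] [NormedAlgebra ℂ A] [CompleteSpace A]
    (a b e : A) (ha : IsGDrazinInvertible a) (hb : IsGDrazinInvertible b)
    (hab : spectralIdem a * b * a =
      spectralIdem a * spectralIdem b * a * b * spectralIdem b * spectralIdem a)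
    (hcorner :
      IsGDrazinInvertible (spectralIdem a * b * spectralIdem a) ∨
      IsGDrazinInvertible (spectralIdem a * b) ∨
      IsGDrazinInvertible (b * spectralIdem a) ∨
      IsGDrazinInvertible (a * gDrazin a * b * (a * gDrazin a)) ∨
      IsGDrazinInvertible (a * gDrazin a * b) ∨
      IsGDrazinInvertible (b * (a * gDrazin a)))
    (he : e = (a + b) * (a * gDrazin a)) :
    [IsGDrazinInvertible (a + b),
      IsGDrazinInvertible (a * gDrazin a * (a + b)),
      IsGDrazinInvertible e,
      IsGDrazinInvertible (a * gDrazin a * (a + b) * (a * gDrazin a))].TFAE ∧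
    (IsGDrazinInvertible (a + b) →
      Summable (fun n : ℕ => spectralIdem a * a ^ n * gDrazin b ^ (n + 1)) ∧
      Summable (fun n : ℕ =>
        gDrazin e * b * spectralIdem a * a ^ n * gDrazin b ^ (n + 1)) ∧
      Summable (fun q : ℕ × ℕ =>
        spectralIdem e * e ^ q.1 * (a * gDrazin a) * b * a ^ q.2 * spectralIdem a *
          gDrazin b ^ (q.1 + q.2 + 2)) ∧
      Summable (fun n : ℕ =>
        gDrazin e ^ (n + 2) * b * spectralIdem a * (a + b) ^ n * spectralIdem b) ∧
      Summable (fun q : ℕ × ℕ =>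
        gDrazin e ^ (q.1 + 2) * b * spectralIdem a * (a + b) ^ q.1 * a ^ (q.2 + 1) *
          gDrazin b ^ (q.2 + 1)) ∧
      gDrazin (a + b) =
        gDrazin e
        + ∑' n : ℕ, spectralIdem a * a ^ n * gDrazin b ^ (n + 1)
        - ∑' n : ℕ, gDrazin e * b * spectralIdem a * a ^ n * gDrazin b ^ (n + 1)
        + ∑' n : ℕ, ∑' k : ℕ,
            spectralIdem e * e ^ n * (a * gDrazin a) * b * a ^ k * spectralIdem a *
              gDrazin b ^ (n + k + 2)
        + ∑' n : ℕ,
            gDrazin e ^ (n + 2) * b * spectralIdem a * (a + b) ^ n * spectralIdem b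
        - ∑' n : ℕ, ∑' k : ℕ,
            gDrazin e ^ (n + 2) * b * spectralIdem a * (a + b) ^ n * a ^ (k + 1) *
              gDrazin b ^ (k + 1)) := by
  have hd := gDrazin_spec ha
  have hB := gDrazin_spec hb
  have hue : spectralIdem a = 1 - a * gDrazin a := rfl
  have hfe : spectralIdem b = 1 - b * gDrazin b := rfl
  have hXe : spectralIdem e = 1 - e * gDrazin e := rfl
  generalize gDrazin a = d at *
  generalize gDrazin b = B at *
  generalize spectralIdem a = u at *
  generalize spectralIdem b = f at *
  generalize spectralIdem e = eπ at *
  obtain ⟨p, hp⟩ : ∃ p, p = a * d := ⟨_, rfl⟩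
  rw [← hp] at hue hcorner he ⊢
  have hpp : p * p = p := by rw [hp, mul_assoc, ← mul_assoc d, hd.outer]
  have hpu : p + u = 1 := by rw [hue]; abel
  have huu : u * u = u := by rw [hue, sub_mul, mul_sub p, hpp]; simp
  have hup : u * p = 0 := by rw [hue, sub_mul, hpp]; simp
  have hpu0 : p * u = 0 := by rw [hue, mul_sub, hpp]; simp
  have hap : a * p = p * a := by rw [hp, mul_assoc, hd.comm]
  have hau : a * u = u * a := by rw [hue, mul_sub, sub_mul, hap]; simp
  have haq : IsQuasinilpotent (u * a) := by
    have h : u * a = a - a ^ 2 * d := by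
      rw [← hau, hue, hp]; noncomm_ring
    exact h ▸ hd.quasinil
  have hud : u * d = 0 := by
    rw [hue, hp, sub_mul, hd.comm, hd.outer, one_mul, sub_self]
  have hubp : u * b * p = 0 := by
    rw [hp, ← mul_assoc, hab]
    simp only [mul_assoc, hud, mul_zero]
  have hu : ∀ t : A, u * t * p = 0 → u * t * u = u * t := fun t ht => by
    calc u * t * u = u * t * p + u * t * u := by rw [ht, zero_add]
      _ = u * t := by rw [← mul_add, hpu, mul_one]
  have hub : u * b * u = u * b := hu b hubp
  have hpbp : p * b * p = b * p := by
    calc p * b * p = p * b * p + u * b * p := by rw [hubp, add_zero]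
      _ = b * p := by rw [← add_mul, ← add_mul, hpu, one_mul]
  have hcorner' : IsGDrazinInvertible (u * b) ∨ IsGDrazinInvertible (b * p) := by
    rw [hub, hpbp] at hcorner
    rcases hcorner with h | h | h | h | h | h
    · exact .inl h
    · exact .inl h
    · exact .inl (isGDrazinInvertible_mul_comm.1 h)
    · exact .inr h
    · exact .inr (isGDrazinInvertible_mul_comm.1 h)
    · exact .inr h
  obtain ⟨huB, hB2⟩ := hB.mul_left_of_triangular hpu huu hup hubp hcorner'
  -- The spectral idempotent of u * b in the whole algebra, so g = p + u * f rather than u * f.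
  obtain ⟨g, hg⟩ : ∃ g, g = 1 - u * b * (u * B) := ⟨_, rfl⟩
  have hubB : u * b * (u * B) = u * (b * B) := by
    rw [← mul_assoc, hub, mul_assoc]
  have hug : u * g = u * f := by
    rw [hg, hfe, mul_sub, mul_sub, hubB, ← mul_assoc, huu]
  have hufu : u * f * u = u * f := by
    rw [hfe, mul_sub, sub_mul, ← hubB, mul_one, huu, mul_assoc, huB]
  have hgu : g * u = u * f := by
    rw [hg, hfe, sub_mul, mul_assoc, huB, hubB, mul_sub, one_mul, mul_one]
  have hba : u * b * (u * a) = g * (u * a) * (u * b) * g := by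
    calc u * b * (u * a) = u * b * u * a := by rw [mul_assoc (u * b)]
      _ = u * f * a * b * f * u := by rw [hub, hab]
      _ = u * f * u * a * b * f * u := by rw [hufu]
      _ = u * f * (u * a) * b * f * u := by simp only [mul_assoc]
      _ = u * f * (a * (u * u)) * b * f * u := by rw [huu, hau]
      _ = u * f * (a * u) * (u * b) * f * u := by simp only [mul_assoc]
      _ = u * f * a * u * (u * b * u) * f * u := by rw [hub]; simp only [mul_assoc]
      _ = u * f * a * u * (u * b) * (u * f * u) := by simp only [mul_assoc]
      _ = u * f * a * u * (u * b) * (u * g) := by rw [hufu, hug]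
      _ = u * f * a * u * (u * b * u) * g := by simp only [mul_assoc]
      _ = g * u * (a * u) * (u * b) * g := by rw [hub, hgu]; simp only [mul_assoc]
      _ = g * (u * u) * a * (u * b) * g := by rw [hau]; simp only [mul_assoc]
      _ = g * (u * a) * (u * b) * g := by rw [huu]; simp only [mul_assoc]
  obtain ⟨T, G, hT, hG, hTd, hyT, hBa0, hbaB, hkq, hkpow⟩ := haq.isGDrazinInverse_add hB2 hg hba
  obtain ⟨y, hy⟩ : ∃ y, y = u * a + u * b := ⟨_, rfl⟩
  rw [← hy] at hTd hyT hkpow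
  have hyw : y = u * (a + b) := by rw [hy, mul_add]
  have huy : u * y = y := by rw [hyw, ← mul_assoc, huu]
  have hyu : y * u = y := by rw [hy, add_mul, hub, ← hau, mul_assoc, huu]
  have hyu' : y * u = u * (a + b) := by rw [hyu, hyw]
  have hpe : p * e = e := by
    rw [he, add_mul, mul_add, ← mul_assoc, ← mul_assoc, hpbp, ← hap, mul_assoc, hpp]
  have hep : e * p = e := by rw [he, mul_assoc, hpp]
  obtain ⟨z, hz⟩ : ∃ z, z = p * b * u := ⟨_, rfl⟩
  have hsum : a + b = e + y + z := by
    have h1 : p * a * u = 0 := by rw [← hap, mul_assoc, hpu0, mul_zero]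
    calc a + b = (a + b) * p + (p + u) * (a + b) * u := by
          rw [hpu, one_mul, ← mul_add, hpu, mul_one]
      _ = e + (u * (a + b) * u + p * a * u + p * b * u) := by
          rw [he]; simp only [add_mul, mul_add]; abel
      _ = e + y + z := by
          rw [← hyw, hyu, h1, hz]; abel
  have h31 : ∀ X, IsGDrazinInverse e X →
      ∃ S R : A, HasSum (fun n : ℕ => X ^ (n + 2) * z * y ^ n * (1 - y * T)) S ∧
      HasSum (fun n : ℕ => (1 - e * X) * e ^ n * z * T ^ (n + 2)) R ∧
      IsGDrazinInverse (a + b) (X + T + (S + R - X * z * T)) := fun X hX => by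
    rw [hsum]
    refine hX.triangular hTd ?_ ?_ ?_ ?_ ?_
    · rw [← hep, ← huy, mul_assoc, ← mul_assoc p, hpu0, zero_mul, mul_zero]
    · rw [← hpe, ← hyu, mul_assoc, ← mul_assoc u, hup, zero_mul, mul_zero]
    · rw [hz, ← hpe, mul_assoc, ← mul_assoc u, hup, zero_mul, mul_zero]
    · rw [hz, ← hyu, mul_assoc, mul_assoc p, ← mul_assoc u, hup, zero_mul, mul_zero]
    · rw [hz, mul_assoc, mul_assoc p b u, ← mul_assoc u p, hup, zero_mul, mul_zero]
  -- As y is in A^d unconditionally, intertwining forces u * W * p = 0, and W restricts to the block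
  -- of p.
  have h13 : IsGDrazinInvertible (a + b) → IsGDrazinInvertible e := by
    rintro ⟨W, hW⟩
    have h1 : T * u = u * W := hW.intertwine hTd hyu'
    have h2 : u * W * p = 0 := by rw [← h1, mul_assoc, hup, mul_zero]
    have h3 : p * W * p = W * p := by
      calc p * W * p = p * W * p + u * W * p := by rw [h2, add_zero]
        _ = W * p := by rw [← add_mul, ← add_mul, hpu, one_mul]
    exact ⟨_, he ▸ hW.mul_right_of_invariant (by rw [mul_assoc, ← he, hpe]) h3⟩
  refine ⟨?_, fun hw => ?_⟩
  · tfae_have 1 → 3 := h13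
    tfae_have 3 → 1 := fun ⟨X, hX⟩ => by
      obtain ⟨S, R, -, -, h⟩ := h31 X hX
      exact ⟨_, h⟩
    tfae_have 2 ↔ 3 := he ▸ isGDrazinInvertible_mul_comm
    tfae_have 3 ↔ 4 := by rw [mul_assoc, ← he, hpe]
    tfae_finish
  have hX := gDrazin_spec (h13 hw)
  obtain ⟨S, R, hS, hR, hW⟩ := h31 _ hX
  rw [hW.gDrazin_eq]
  generalize gDrazin e = X at *
  have hXp : X * p = X := by
    have h : X = X * X * e := by rw [mul_assoc, ← hX.comm, ← mul_assoc, hX.outer]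
    rw [h, mul_assoc, hep]
  have hXpp : ∀ n : ℕ, X ^ (n + 1) * p = X ^ (n + 1) := fun n => by
    rw [pow_succ, mul_assoc, hXp]
  have hua : ∀ n : ℕ, (u * a) ^ n * u = u * a ^ n := fun n => by
    induction n with
    | zero => simp
    | succ n ih =>
      rw [pow_succ, mul_assoc, mul_assoc u, hau, ← mul_assoc u, huu, ← mul_assoc, ih, mul_assoc,
        ← pow_succ]
  have hcu : ∀ n : ℕ, a ^ n * u = u * a ^ n := fun n =>
    (Commute.pow_left (show Commute a u from hau) n).eq
  have huBn : ∀ n : ℕ, (u * B) ^ (n + 1) = u * B ^ (n + 1) := fun n => by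
    induction n with
    | zero => simp
    | succ n ih => rw [pow_succ', ih, ← mul_assoc, huB, mul_assoc, ← pow_succ']
  have hterm : ∀ n m : ℕ, (u * a) ^ n * (u * B) ^ (m + 1) = u * a ^ n * B ^ (m + 1) :=
    fun n m => by rw [huBn, ← mul_assoc, hua]
  have hT' : HasSum (fun n : ℕ => u * a ^ n * B ^ (n + 1)) T := by
    simpa only [hterm] using hT
  have huT : u * T = T := by
    refine (hT'.mul_left u).unique ?_
    simpa only [← mul_assoc, huu] using hT'
  have hzT : X * b * T = X * z * T := by
    rw [hz, mul_assoc p, ← mul_assoc X p, hXp, mul_assoc X (b * u), mul_assoc b u, huT, mul_assoc]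
  have hXT : HasSum (fun n : ℕ => X * b * u * a ^ n * B ^ (n + 1)) (X * z * T) := by
    rw [← hzT]
    simpa only [← mul_assoc] using hT'.mul_left (X * b)
  have hBT : u * B * T = u * B * (u * B) := by
    refine (hT.mul_left (u * B)).unique ?_
    convert hasSum_single 0 _ using 1
    · simp
    · intro n hn
      obtain ⟨m, rfl⟩ := Nat.exists_eq_succ_of_ne_zero hn
      rw [Nat.succ_eq_add_one, pow_succ' (u * a), mul_assoc (u * a), ← mul_assoc (u * B), hBa0,
        zero_mul]
  -- Powers of T remain single series: multiplying a term by T only adds a factor B, by `hBT`.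
  have hTpow : ∀ m : ℕ, HasSum (fun k : ℕ => u * a ^ k * B ^ (k + m + 1)) (T ^ (m + 1)) := by
    intro m
    induction m with
    | zero => simpa using hT'
    | succ m ih =>
      rw [pow_succ T]
      have h : ∀ k : ℕ, u * a ^ k * B ^ (k + m + 1) * T = u * a ^ k * B ^ (k + (m + 1) + 1) :=
        fun k => by
          rw [← hterm, ← hterm, pow_succ (u * B) (k + m), mul_assoc, mul_assoc ((u * B) ^ (k + m)),
            hBT, ← mul_assoc ((u * B) ^ (k + m)), ← pow_succ, ← pow_succ, ← add_assoc k m 1]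
      simpa only [h] using ih.mul_right T
  have hRterm : ∀ n : ℕ, HasSum (fun k : ℕ => eπ * e ^ n * p * b * a ^ k * u * B ^ (n + k + 2))
      (eπ * e ^ n * z * T ^ (n + 2)) := fun n => by
    have h : ∀ k : ℕ, eπ * e ^ n * z * (u * a ^ k * B ^ (k + (n + 1) + 1))
        = eπ * e ^ n * p * b * a ^ k * u * B ^ (n + k + 2) := fun k => by
      rw [mul_assoc _ (a ^ k) u, hcu, hz, show k + (n + 1) + 1 = n + k + 2 by ring]
      calc eπ * e ^ n * (p * b * u) * (u * a ^ k * B ^ (n + k + 2))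
          = eπ * e ^ n * p * b * ((u * u) * a ^ k) * B ^ (n + k + 2) := by simp only [mul_assoc]
        _ = _ := by rw [huu]
    simpa only [h] using (hTpow (n + 1)).mul_left (eπ * e ^ n * z)
  have hun : ∀ n : ℕ, y ^ n * u = u * (a + b) ^ n := fun n =>
    (SemiconjBy.pow_right (show SemiconjBy u (a + b) y from hyu'.symm) n).eq.symm
  have hunu : ∀ n : ℕ, u * (a + b) ^ n * u = u * (a + b) ^ n := fun n => by
    rw [← hun, mul_assoc, huu]
  -- Here y acts as u * a, since u * b annihilates (u * a) ^ (k + 1) * (u * B).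
  have hyn : ∀ n k : ℕ, y ^ n * ((u * a) ^ (k + 1) * (u * B)) = (u * a) ^ (n + k + 1) * (u * B) := by
    intro n k
    induction n with
    | zero => simp
    | succ n ih =>
      rw [pow_succ', mul_assoc, ih, hy, add_mul, hbaB, add_zero, ← mul_assoc, ← pow_succ',
        show n + 1 + k + 1 = n + k + 1 + 1 by ring]
  have hSterm : ∀ n k : ℕ, u * (a + b) ^ n * a ^ (k + 1) * B ^ (k + 1)
      = (u * a) ^ (n + k + 1) * (u * B) ^ (k + 1) := fun n k => by
    calc u * (a + b) ^ n * a ^ (k + 1) * B ^ (k + 1)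
        = y ^ n * (u * a ^ (k + 1) * B ^ (k + 1)) := by rw [← hun]; simp only [mul_assoc]
      _ = y ^ n * ((u * a) ^ (k + 1) * (u * B)) * (u * B) ^ k := by
        rw [← hterm, pow_succ' (u * B)]; simp only [mul_assoc]
      _ = _ := by rw [hyn, pow_succ' (u * B)]; simp only [mul_assoc]
  have hSG : ∀ n : ℕ, HasSum
      (fun k : ℕ => X ^ (n + 2) * b * u * (a + b) ^ n * a ^ (k + 1) * B ^ (k + 1))
      (X ^ (n + 2) * b * u * (a + b) ^ n * G) := fun n => by
    have h : ∀ k : ℕ, X ^ (n + 2) * b * u * (a + b) ^ n * ((u * a) ^ (k + 1) * (u * B) ^ (k + 1))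
        = X ^ (n + 2) * b * u * (a + b) ^ n * a ^ (k + 1) * B ^ (k + 1) := fun k => by
      calc X ^ (n + 2) * b * u * (a + b) ^ n * ((u * a) ^ (k + 1) * (u * B) ^ (k + 1))
          = X ^ (n + 2) * b * (u * (a + b) ^ n * u) * a ^ (k + 1) * B ^ (k + 1) := by
            rw [hterm]; simp only [mul_assoc]
        _ = _ := by rw [hunu]; simp only [mul_assoc]
    simpa only [h] using hG.mul_left (X ^ (n + 2) * b * u * (a + b) ^ n)
  -- After absorption of u, the factor 1 - y * T is f - G; this splits S into the last two series of
  -- the formula.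
  have hSsplit : ∀ n : ℕ, X ^ (n + 2) * z * y ^ n * (1 - y * T)
      = X ^ (n + 2) * b * u * (a + b) ^ n * f - X ^ (n + 2) * b * u * (a + b) ^ n * G := fun n => by
    have h1 : u * y ^ n = y ^ n * u :=
      (Commute.pow_right (show Commute u y from huy.trans hyu.symm) n).eq
    have h2 : X ^ (n + 2) * z * y ^ n = X ^ (n + 2) * b * u * (a + b) ^ n := by
      rw [hz, mul_assoc p b u, ← mul_assoc _ p, hXpp, mul_assoc, mul_assoc b u, h1, hun]
      simp only [mul_assoc]
    have h3 : X ^ (n + 2) * b * u * (a + b) ^ n * u = X ^ (n + 2) * b * u * (a + b) ^ n := by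
      have := congrArg (fun t => X ^ (n + 2) * b * t) (hunu n)
      simpa only [← mul_assoc] using this
    rw [h2, hyT, hubB, hfe, mul_sub, mul_add, ← mul_assoc _ u, h3, mul_sub, sub_sub]
  -- Although y need not be quasinilpotent, y ^ n * g is governed by the quasinilpotent element u *
  -- a * g + u * b * g.
  have hs4 : Summable fun n : ℕ => X ^ (n + 2) * b * u * (a + b) ^ n * f := by
    have h : ∀ n : ℕ, X ^ (n + 2) * b * u * (a + b) ^ n * f
        = X ^ n * (X ^ 2 * b) * ((u * a * g + u * b * g) ^ n * (g * u)) := fun n => by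
      calc X ^ (n + 2) * b * u * (a + b) ^ n * f
          = X ^ n * (X ^ 2 * b) * (u * (a + b) ^ n * u * f) := by
            rw [hunu, pow_add]; simp only [mul_assoc]
        _ = X ^ n * (X ^ 2 * b) * (y ^ n * (u * u) * f) := by rw [← hun]; simp only [mul_assoc]
        _ = X ^ n * (X ^ 2 * b) * (y ^ n * g * u) := by
          rw [huu, mul_assoc (y ^ n) u f, ← hgu, mul_assoc (y ^ n)]
        _ = _ := by rw [hkpow, mul_assoc ((u * a * g + u * b * g) ^ n)]
    refine Summable.of_norm_bounded
      ((hkq.summable_norm_pow_mul_norm_pow X).mul_left (‖X ^ 2 * b‖ * ‖g * u‖)) fun n => ?_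
    rw [h]
    refine (norm_mul_le_of_le (norm_mul_le _ _) (norm_mul_le _ _)).trans (le_of_eq ?_)
    ring
  have hs3 : Summable fun q : ℕ × ℕ =>
      eπ * e ^ q.1 * p * b * a ^ q.2 * u * B ^ (q.1 + q.2 + 2) := by
    have h : ∀ n k : ℕ, eπ * e ^ n * p * b * a ^ k * u * B ^ (n + k + 2)
        = eπ * (e - e ^ 2 * X) ^ n * (p * b) * ((u * a) ^ k * u) * (B ^ n * B ^ k * B ^ 2) :=
      fun n k => by
        rw [hua, ← hcu, hXe, (hX.pow_mul_one_sub n).2, pow_add, pow_add]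
        simp only [mul_assoc]
    refine Summable.of_norm_bounded ((((show IsQuasinilpotent (e - e ^ 2 * X) from
      hX.quasinil).summable_norm_pow_mul_norm_pow B).mul_of_nonneg
      (haq.summable_norm_pow_mul_norm_pow B) (fun n => by positivity)
      (fun n => by positivity)).mul_left (‖eπ‖ * ‖p * b‖ * ‖u‖ * ‖B ^ 2‖)) fun q => ?_
    rw [h]
    refine (norm_mul_le_of_le (norm_mul_le_of_le (norm_mul_le_of_le (norm_mul_le _ _) le_rfl)
      (norm_mul_le _ _)) (norm_mul_le_of_le (norm_mul_le _ _) le_rfl)).trans (le_of_eq ?_)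
    ring
  -- The power (u * a) ^ (n + k + 1) is shared out: n factors control X ^ n and k factors control (u
  -- * B) ^ k.
  have hs5 : Summable fun q : ℕ × ℕ =>
      X ^ (q.1 + 2) * b * u * (a + b) ^ q.1 * a ^ (q.2 + 1) * B ^ (q.2 + 1) := by
    have h : ∀ n k : ℕ, X ^ (n + 2) * b * u * (a + b) ^ n * a ^ (k + 1) * B ^ (k + 1)
        = X ^ n * (X ^ 2 * b) * ((u * a) ^ n * ((u * a) ^ k * (u * a)) * ((u * B) ^ k * (u * B))) :=
      fun n k => by
        rw [← pow_succ, ← pow_add, ← pow_succ, ← add_assoc, ← hSterm, pow_add X]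
        simp only [mul_assoc]
    refine Summable.of_norm_bounded (((haq.summable_norm_pow_mul_norm_pow X).mul_of_nonneg
      (haq.summable_norm_pow_mul_norm_pow (u * B)) (fun n => by positivity)
      (fun n => by positivity)).mul_left (‖X ^ 2 * b‖ * ‖u * a‖ * ‖u * B‖)) fun q => ?_
    rw [h]
    refine (norm_mul_le_of_le (norm_mul_le _ _) (norm_mul_le_of_le (norm_mul_le_of_le le_rfl
      (norm_mul_le _ _)) (norm_mul_le _ _))).trans (le_of_eq ?_)
    ring
  refine ⟨hT'.summable, hXT.summable, hs3, hs4, hs5, ?_⟩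
  obtain ⟨S₁, hS₁⟩ := hs4
  have hS₂ : HasSum (fun n : ℕ => X ^ (n + 2) * b * u * (a + b) ^ n * G) (S₁ - S) := by
    simpa only [hSsplit, sub_sub_cancel] using hS₁.sub hS
  rw [hT'.tsum_eq, hXT.tsum_eq, hS₁.tsum_eq, tsum_congr fun n => (hSG n).tsum_eq, hS₂.tsum_eq,
    tsum_congr fun n => (hRterm n).tsum_eq, hXe, hR.tsum_eq]
  abel
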